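/- Let $\mathbb{K}$ be a field, $d\ge 0$ an integer, $\mathcal A$ a $\mathbb{K}$-algebra isomorphic to the algebra $\mathrm{Mat}_{d+1}(\mathbb{K})$ of $(d+1)\times(d+1)$ matrices, and $V$ a simple left $\mathcal A$-module (so $\dim_{\mathbb{K}} V=d+1$). An element $A\in\mathcal A$ is multiplicity-free if it has $d+1$ mutually distinct eigenvalues in $\mathbb{K}$; if $\theta_0,\dots,\theta_d$ is an ordering of them, the primitive idempotent of $A$ associated with $\theta_i$ is $E_i=\prod_{j\ne i}\frac{A-\theta_jI}{\theta_i-\theta_j}$. A Leonard system in $\mathcal A$ is a sequence $\Phi=(A;\{E_i\}_{i=0}^d;A^*;\{E^*_i\}_{i=0}^d)$ in which $A,A^*\in\mathcal A$ are multiplicity-free, $\{E_i\}$ and $\{E^*_i\}$ are orderings of the primitive idempotents of $A$ and of $A^*$, and for $0\le i,j\le d$ each of $E_iA^*E_j$ and $E^*_iAE^*_j$ is zero if $|i-j|>1$ and nonzero if $|i-j|=1$. Let $\theta_i$ (resp. $\theta^*_i$) be the eigenvalue of $A$ (resp. $A^*$) associated with $E_i$ (resp. $E^*_i$), and put $\tau_i(\lambda)=\prod_{h=0}^{i-1}(\lambda-\theta_h)$,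 $\eta_i(\lambda)=\prod_{h=0}^{i-1}(\lambda-\theta_{d-h})$ and, for $1\le i\le d$, $$\varphi_i=(\theta^*_0-\theta^*_i)\frac{\mathrm{tr}(\tau_i(A)E^*_0)}{\mathrm{tr}(\tau_{i-1}(A)E^*_0)},\qquad \phi_i=(\theta^*_0-\theta^*_i)\frac{\mathrm{tr}(\eta_i(A)E^*_0)}{\mathrm{tr}(\eta_{i-1}(A)E^*_0)}.$$ The switching element of $\Phi$ is $$S=\sum_{r=0}^d\frac{\phi_d\phi_{d-1}\cdots\phi_{d-r+1}}{\varphi_1\varphi_2\cdots\varphi_r}\,E_r .$$ A decomposition of $V$ is a sequence $\{V_i\}_{i=0}^d$ of one-dimensional subspaces whose direct sum is $V$. Flags $\{F_i\}_{i=0}^d$, $\{F'_i\}_{i=0}^d$ on $V$ are opposite if there is a decomposition $\{V_i\}_{i=0}^d$ of $V$ with $F_i=V_0+\cdots+V_i$ and $F'_i=V_d+V_{d-1}+\cdots+V_{d-i}$ for $0\le i\le d$; this decomposition is then unique, namely $V_i=F_i\cap F'_{d-i}$, and is called the decomposition induced by the two flags. Let $[0],[D],[0^*],[D^*]$ be the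 flags on $V$ whose $i$-th components are, respectively, $$E_0V+\cdots+E_iV,\quad E_dV+\cdots+E_{d-i}V,\quad E^*_0V+\cdots+E^*_iV,\quad E^*_dV+\cdots+E^*_{d-i}V .$$ **Theorem 9.1.** The four flags $[0],[D],[0^*],[D^*]$ are mutually opposite. For distinct $z,w\in\{0,D,0^*,D^*\}$ let $[zw]$ be the decomposition of $V$ induced by $[z],[w]$. Then for every nonzero $X\in\mathcal A$ the following are equivalent: (i) $X$ is a scalar multiple of $S$; (ii) $X[0^*0]\subseteq[D^*0]$ and $X[0^*D]\subseteq[D^*D]$. If (i), (ii) hold, then $X[0^*0]=[D^*0]$ and $X[0^*D]=[D^*D]$. Here, for sequences $F=\{F_i\}_{i=0}^d$, $F'=\{F'_i\}_{i=0}^d$ of subspaces, $XF=\{XF_i\}_{i=0}^d$, and inclusion and equality are meant componentwise. -/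

import Mathlib

open Polynomial

noncomputable section

namespace Leonard

/-! Flags and decompositions of a `K`-vector space, both indexed by `0, 1, …, d`. -/

section Sequences

variable {K : Type*} [Field K] {V : Type*} [AddCommGroup V] [Module K V] {d : ℕ}

/-- A decomposition of `V`: one-dimensional subspaces `V_0, …, V_d` whose direct sum is `V`. -/
structure IsDecomposition (U : Fin (d + 1) → Submodule K V) : Prop where
  finrank_eq_one : ∀ i, Module.finrank K (U i) = 1
  isInternal : DirectSum.IsInternal U

/-- The sequence of partial sums `F_i = V_0 + V_1 + ⋯ + V_i`; this is the flag induced by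
the decomposition `V_0, …, V_d`. -/
def partialSums (U : Fin (d + 1) → Submodule K V) (i : Fin (d + 1)) : Submodule K V :=
  ⨆ j ∈ Finset.Iic i, U j

/-- The inversion `V_d, V_{d-1}, …, V_0` of a sequence. -/
def inversion (U : Fin (d + 1) → Submodule K V) (i : Fin (d + 1)) : Submodule K V :=
  U i.rev

/-- The decomposition `U` induces the pair of flags `F`, `F'`, that is,
`F_i = V_0 + ⋯ + V_i` and `F'_i = V_d + ⋯ + V_{d-i}` for all `i`. -/
structure InducesFlags (U F F' : Fin (d + 1) → Submodule K V) : Prop where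
  isDecomposition : IsDecomposition U
  fst_eq : F = partialSums U
  snd_eq : F' = partialSums (inversion U)

/-- Two flags are opposite if some decomposition of `V` induces the first, and its inversion
the second (both sequences are then automatically flags). -/
def Opposite (F F' : Fin (d + 1) → Submodule K V) : Prop :=
  ∃ U : Fin (d + 1) → Submodule K V, InducesFlags U F F'

/-- The decomposition induced by a pair of opposite flags: its `i`-th component is
`F_i ∩ F'_{d-i}`. By `InducesFlags.eq_inducedDecomposition` below, for opposite flags this is
the unique decomposition that induces them. -/
def inducedDecomposition (F F' : Fin (d + 1) → Submodule K V) (i : Fin (d + 1)) :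
    Submodule K V :=
  F i ⊓ F' i.rev

theorem InducesFlags.eq_inducedDecomposition {U F F' : Fin (d + 1) → Submodule K V}
    (h : InducesFlags U F F') : U = inducedDecomposition F F' := by
  have hind : iSupIndep U := h.isDecomposition.isInternal.submodule_iSupIndep
  funext i
  have hF' : F' i.rev = ⨆ j ∈ {j : Fin (d + 1) | i ≤ j}, U j := by
    rw [h.snd_eq]
    apply le_antisymm
    · refine iSup₂_le fun j hj => ?_
      have hj' : i ≤ j.rev := by
        rw [Fin.le_rev_iff]
        exact Finset.mem_Iic.1 hj
      exact le_iSup₂_of_le (f := fun j (_ : j ∈ {j : Fin (d + 1) | i ≤ j}) => U j)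
        j.rev hj' le_rfl
    · refine iSup₂_le fun j hj => ?_
      have hj' : j.rev ∈ Finset.Iic i.rev := Finset.mem_Iic.2 (Fin.rev_le_rev.2 hj)
      refine le_iSup₂_of_le (f := fun j (_ : j ∈ Finset.Iic i.rev) => inversion U j)
        j.rev hj' ?_
      simp [inversion]
  have hF : F i = U i ⊔ ⨆ j ∈ {j : Fin (d + 1) | j < i}, U j := by
    rw [h.fst_eq]
    apply le_antisymm
    · refine iSup₂_le fun j hj => ?_
      rcases (Finset.mem_Iic.1 hj).eq_or_lt with rfl | hlt
      · exact le_sup_left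
      · exact le_sup_of_le_right
          (le_iSup₂_of_le (f := fun j (_ : j ∈ {j : Fin (d + 1) | j < i}) => U j) j hlt le_rfl)
    · refine sup_le ?_ (iSup₂_le fun j hj => ?_)
      · exact le_iSup₂_of_le (f := fun j (_ : j ∈ Finset.Iic i) => U j) i (by simp) le_rfl
      · exact le_iSup₂_of_le (f := fun j (_ : j ∈ Finset.Iic i) => U j) j
          (Finset.mem_Iic.2 (le_of_lt hj)) le_rfl
  have hle : U i ≤ ⨆ j ∈ {j : Fin (d + 1) | i ≤ j}, U j :=
    le_iSup₂_of_le (f := fun j (_ : j ∈ {j : Fin (d + 1) | i ≤ j}) => U j) i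
      (le_refl i) le_rfl
  have hdisj : (⨆ j ∈ {j : Fin (d + 1) | j < i}, U j) ⊓
      (⨆ j ∈ {j : Fin (d + 1) | i ≤ j}, U j) = ⊥ := by
    refine (hind.disjoint_biSup_biSup ?_).eq_bot
    exact Set.disjoint_left.2 fun j hj hj' => absurd (show j < i from hj) (not_lt.2 hj')
  rw [inducedDecomposition, hF, hF', sup_inf_assoc_of_le _ hle, hdisj, sup_bot_eq]

end Sequences

/-! An algebra `𝒜` over `K` that acts on `V`. -/

section Action

variable {K : Type*} [Field K] {𝒜 : Type*} [Ring 𝒜] [Algebra K 𝒜]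
  (V : Type*) [AddCommGroup V] [Module K V] [Module 𝒜 V] [IsScalarTower K 𝒜 V]

/-- The `K`-linear transformation `v ↦ X v` of `V` given by an element `X` of `𝒜`. -/
def act (X : 𝒜) : V →ₗ[K] V :=
  Algebra.lsmul K K V X

/-- The subspace `X V`. -/
def imageOf (X : 𝒜) : Submodule K V :=
  LinearMap.range (act (K := K) V X)

/-- The trace of an element of `𝒜`, as a linear transformation of `V`. -/
def tr (X : 𝒜) : K :=
  LinearMap.trace K V (act (K := K) V X)

variable {V}

/-- The sequence `X F_0, X F_1, …, X F_d`. -/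
def applySeq {d : ℕ} (X : 𝒜) (F : Fin (d + 1) → Submodule K V) (i : Fin (d + 1)) :
    Submodule K V :=
  (F i).map (act (K := K) V X)

variable (V)

/-- `A` is multiplicity-free, `θ_0, …, θ_d` are its (`d + 1` mutually distinct) eigenvalues, and
`E_i = ∏_{j ≠ i} (A - θ_j I) / (θ_i - θ_j)` is the primitive idempotent of `A` associated with
`θ_i`. -/
structure IsPrimitiveIdempotentOrdering {d : ℕ} (A : 𝒜) (θ : Fin (d + 1) → K)
    (E : Fin (d + 1) → 𝒜) : Prop where
  injective : Function.Injective θ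
  hasEigenvalue : ∀ i, Module.End.HasEigenvalue (act (K := K) V A) (θ i)
  eq_prod : ∀ i, E i = aeval A
    (∏ j ∈ Finset.univ.erase i, (C (θ i - θ j)⁻¹ * (X - C (θ j))))

end Action

/-- A Leonard system `(A; E_0, …, E_d; A*; E*_0, …, E*_d)` in `𝒜`, where `A*`, `E*` are written
`As`, `Es`. The eigenvalue sequence `θ` and the dual eigenvalue sequence `θs` are recorded as
well; they are determined by the rest, since `θ i` is the eigenvalue of `A` on `E_i V` and
`θs i` is that of `A*` on `E*_i V`. -/
structure LeonardSystem (K : Type*) [Field K] (𝒜 : Type*) [Ring 𝒜] [Algebra K 𝒜]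
    (V : Type*) [AddCommGroup V] [Module K V] [Module 𝒜 V] [IsScalarTower K 𝒜 V] (d : ℕ) where
  A : 𝒜
  E : Fin (d + 1) → 𝒜
  As : 𝒜
  Es : Fin (d + 1) → 𝒜
  θ : Fin (d + 1) → K
  θs : Fin (d + 1) → K
  idempotents : IsPrimitiveIdempotentOrdering V A θ E
  idempotents_dual : IsPrimitiveIdempotentOrdering V As θs Es
  tridiagonal_dual : ∀ i j : Fin (d + 1),
    (1 < |(i : ℤ) - (j : ℤ)| → E i * As * E j = 0) ∧
    (|(i : ℤ) - (j : ℤ)| = 1 → E i * As * E j ≠ 0)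
  tridiagonal : ∀ i j : Fin (d + 1),
    (1 < |(i : ℤ) - (j : ℤ)| → Es i * A * Es j = 0) ∧
    (|(i : ℤ) - (j : ℤ)| = 1 → Es i * A * Es j ≠ 0)

/-- The set of four symbols `0`, `D`, `0*`, `D*`. -/
inductive Omega
  | zero
  | D
  | zeroStar
  | DStar

namespace LeonardSystem

variable {K : Type*} [Field K] {𝒜 : Type*} [Ring 𝒜] [Algebra K 𝒜]
  {V : Type*} [AddCommGroup V] [Module K V] [Module 𝒜 V] [IsScalarTower K 𝒜 V] {d : ℕ}
  (Φ : LeonardSystem K 𝒜 V d)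

/-- The polynomial `τ_i = (λ - θ_0)(λ - θ_1) ⋯ (λ - θ_{i-1})`. -/
def tau (i : ℕ) : K[X] :=
  ∏ h ∈ Finset.univ.filter (fun h : Fin (d + 1) => (h : ℕ) < i), (X - C (Φ.θ h))

/-- The polynomial `η_i = (λ - θ_d)(λ - θ_{d-1}) ⋯ (λ - θ_{d-i+1})`. -/
def eta (i : ℕ) : K[X] :=
  ∏ h ∈ Finset.univ.filter (fun h : Fin (d + 1) => (h : ℕ) < i), (X - C (Φ.θ h.rev))

/-- The first split sequence; `Φ.firstSplit i` is the scalar usually written `φ_{i+1}` (with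
the letter varphi), so its index `i` runs over `0, …, d - 1`. -/
def firstSplit (i : Fin d) : K :=
  (Φ.θs 0 - Φ.θs i.succ) *
    (tr V (aeval Φ.A (Φ.tau (i + 1)) * Φ.Es 0) / tr V (aeval Φ.A (Φ.tau i) * Φ.Es 0))

/-- The second split sequence; `Φ.secondSplit i` is the scalar usually written `ϕ_{i+1}` (with
the letter phi), so its index `i` runs over `0, …, d - 1`. -/
def secondSplit (i : Fin d) : K :=
  (Φ.θs 0 - Φ.θs i.succ) *
    (tr V (aeval Φ.A (Φ.eta (i + 1)) * Φ.Es 0) / tr V (aeval Φ.A (Φ.eta i) * Φ.Es 0))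

/-- The switching element: the sum over `r = 0, …, d` of `E_r` times the product of the last `r`
terms of the second split sequence, divided by the product of the first `r` terms of the first
split sequence. -/
def switchingElement : 𝒜 :=
  ∑ r : Fin (d + 1),
    ((∏ i ∈ Finset.univ.filter (fun i : Fin d => (i : ℕ) < (r : ℕ)), Φ.secondSplit i.rev) /
      (∏ i ∈ Finset.univ.filter (fun i : Fin d => (i : ℕ) < (r : ℕ)), Φ.firstSplit i)) • Φ.E r

/-- The four flags `[0]`, `[D]`, `[0*]`, `[D*]`; the `i`-th components are
`E_0 V + ⋯ + E_i V`, `E_d V + ⋯ + E_{d-i} V`, `E*_0 V + ⋯ + E*_i V`,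
`E*_d V + ⋯ + E*_{d-i} V`. -/
def flag : Omega → Fin (d + 1) → Submodule K V
  | .zero => partialSums fun j => imageOf V (Φ.E j)
  | .D => partialSums (inversion fun j => imageOf V (Φ.E j))
  | .zeroStar => partialSums fun j => imageOf V (Φ.Es j)
  | .DStar => partialSums (inversion fun j => imageOf V (Φ.Es j))

/-- The decomposition `[zw]` of `V` induced by the flags `[z]`, `[w]`. -/
def decomposition (z w : Omega) : Fin (d + 1) → Submodule K V :=
  inducedDecomposition (Φ.flag z) (Φ.flag w)

end LeonardSystem

end Leonard

end

/-! Let `e`, `es` be eigenbases of A and A*, and put u_i = τ_i(A) es_0. Since A is tridiagonal on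
`es` and τ_i kills e_0, …, e_{i-1}, the u_i are triangular with respect to both bases, so they span
the decomposition [0*D]. Reversing `e`, `es` or both gives [0*0], [D*D] and [D*0].

On the u_i the map A* is bidiagonal, with superdiagonal entries the first split sequence. Reading A*
u_{i+1} in `e` (`split_mul_repr_e`) and comparing with the same recursion for reversed `es`, the
entries of A* cancel. The coordinates of es_d and es_0 at e_r therefore have ratio, up to a factor
independent of r, equal to a quotient of products of split sequences. A trace identity
(`split_revEs`) shows that this quotient is the eigenvalue of S on e_r. Thus S sends es_0 to a
nonzero multiple of es_d; as S commutes with A, it sends p(A) es_0 to the same multiple of p(A)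
es_d, which carries the split vectors across.

Conversely, let X respect both pairs of decompositions. Only the vector with index 0 of [0*D] has a
nonzero coordinate at e_0, whereas every vector of [0*0] has one. The first fact determines that
coordinate of X up to a scalar, and the second then forces all the scalars by which X acts on [0*0]
to agree with those of a multiple of S. -/

open Module

namespace Leonard

/-! ### Flags and decompositions spanned by bases -/

section BasisFlags

variable {K : Type*} [Field K] {V : Type*} [AddCommGroup V] [Module K V] {d : ℕ}

/-- The lines spanned by the vectors of a basis. -/
def lines (b : Basis (Fin (d + 1)) K V) (i : Fin (d + 1)) : Submodule K V :=
  Submodule.span K {b i}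

/-- The basis in the reverse order. -/
noncomputable def revBasis (b : Basis (Fin (d + 1)) K V) : Basis (Fin (d + 1)) K V :=
  b.reindex Fin.revPerm

@[simp] theorem revBasis_apply (b : Basis (Fin (d + 1)) K V) (i : Fin (d + 1)) :
    revBasis b i = b i.rev := by
  simp [revBasis]

@[simp] theorem revBasis_repr (b : Basis (Fin (d + 1)) K V) (v : V) (i : Fin (d + 1)) :
    (revBasis b).repr v i = b.repr v i.rev := by
  simp [revBasis]

@[simp] theorem revBasis_revBasis (b : Basis (Fin (d + 1)) K V) :
    revBasis (revBasis b) = b := by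
  ext i; simp

theorem inversion_lines (b : Basis (Fin (d + 1)) K V) :
    inversion (lines b) = lines (revBasis b) := by
  funext i; simp [inversion, lines]

theorem partialSums_lines (b : Basis (Fin (d + 1)) K V) (i : Fin (d + 1)) :
    partialSums (lines b) i = Submodule.span K (b '' Set.Iic i) := by
  have h : (b '' Set.Iic i : Set V) = ⋃ j ∈ Finset.Iic i, {b j} := by
    ext v; simp [eq_comm]
  rw [h, Submodule.span_iUnion₂]
  rfl

theorem mem_partialSums_lines (b : Basis (Fin (d + 1)) K V) (i : Fin (d + 1)) (v : V) :
    v ∈ partialSums (lines b) i ↔ ∀ j, i < j → b.repr v j = 0 := by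
  rw [partialSums_lines, b.mem_span_image]
  constructor
  · intro h j hj
    by_contra hne
    exact absurd (h (Finsupp.mem_support_iff.2 hne)) (not_le.2 hj)
  · intro h j hj
    by_contra hne
    exact (Finsupp.mem_support_iff.1 hj) (h j (not_le.1 hne))

theorem finrank_partialSums_lines (b : Basis (Fin (d + 1)) K V) (i : Fin (d + 1)) :
    finrank K (partialSums (lines b) i) = i + 1 := by
  classical
  rw [partialSums_lines]
  have hli : LinearIndependent K (fun j : Set.Iic i => b j) :=
    b.linearIndependent.comp _ Subtype.val_injective
  have := finrank_span_eq_card hli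
  rw [Set.image_eq_range]
  rw [this]
  simp

/-- Two bases related by a triangular matrix induce the same flag. -/
theorem partialSums_lines_eq_of_triangular (b u : Basis (Fin (d + 1)) K V)
    (h : ∀ i j, i < j → b.repr (u i) j = 0) :
    partialSums (lines u) = partialSums (lines b) := by
  funext i
  have : FiniteDimensional K V := b.finiteDimensional_of_finite
  refine Submodule.eq_of_le_of_finrank_eq ?_ ?_
  · rw [partialSums_lines u, Submodule.span_le]
    rintro _ ⟨k, hk, rfl⟩
    exact (mem_partialSums_lines b i _).2 fun j hj => h k j (lt_of_le_of_lt hk hj)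
  · rw [finrank_partialSums_lines, finrank_partialSums_lines]

theorem isDecomposition_lines (b : Basis (Fin (d + 1)) K V) : IsDecomposition (lines b) where
  finrank_eq_one i := finrank_span_singleton (b.ne_zero i)
  isInternal := by
    rw [DirectSum.isInternal_submodule_iff_iSupIndep_and_iSup_eq_top]
    refine ⟨b.linearIndependent.iSupIndep_span_singleton, ?_⟩
    rw [← b.span_eq, Submodule.span_range_eq_iSup]
    rfl

theorem inducesFlags_lines (b : Basis (Fin (d + 1)) K V) :
    InducesFlags (lines b) (partialSums (lines b)) (partialSums (lines (revBasis b))) :=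
  ⟨isDecomposition_lines b, rfl, by rw [inversion_lines]⟩

theorem inversion_inversion (U : Fin (d + 1) → Submodule K V) :
    inversion (inversion U) = U := by
  funext i; simp [inversion]

theorem IsDecomposition.inversion {U : Fin (d + 1) → Submodule K V} (h : IsDecomposition U) :
    IsDecomposition (inversion U) where
  finrank_eq_one i := h.finrank_eq_one i.rev
  isInternal := by
    have := h.isInternal
    rw [DirectSum.isInternal_submodule_iff_iSupIndep_and_iSup_eq_top] at this ⊢
    refine ⟨this.1.comp Fin.rev_injective, ?_⟩
    rw [← this.2]
    exact Fin.revPerm.iSup_comp (g := U)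

theorem Opposite.symm {F F' : Fin (d + 1) → Submodule K V} (h : Opposite F F') :
    Opposite F' F := by
  obtain ⟨U, h⟩ := h
  exact ⟨inversion U, h.isDecomposition.inversion, h.snd_eq, by
    rw [inversion_inversion, h.fst_eq]⟩

/-- A triangular family with nonzero diagonal is a basis. -/
theorem exists_basis_of_triangular (b : Basis (Fin (d + 1)) K V) (u : Fin (d + 1) → V)
    (h : ∀ i j, i < j → b.repr (u i) j = 0) (hd : ∀ i, b.repr (u i) i ≠ 0) :
    ∃ b' : Basis (Fin (d + 1)) K V, ⇑b' = u := by
  have hdet : IsUnit (b.det u) := by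
    rw [Basis.det_apply, Matrix.det_of_isUpperTriangular]
    · rw [isUnit_iff_ne_zero, Finset.prod_ne_zero_iff]
      intro i _
      exact hd i
    · intro i j hij
      exact h j i hij
  obtain ⟨hli, hsp⟩ := (Basis.is_basis_iff_det b).2 hdet
  exact ⟨Basis.mk hli hsp.ge, Basis.coe_mk _ _⟩

end BasisFlags

end Leonard

namespace Leonard

/-! ### Polynomials in a map with an eigenbasis -/

section

variable {K : Type*} [Field K] {V : Type*} [AddCommGroup V] [Module K V] {d : ℕ}

theorem repr_aeval_apply {b : Basis (Fin (d + 1)) K V} {A : V →ₗ[K] V} {θ : Fin (d + 1) → K}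
    (hb : ∀ i, A (b i) = θ i • b i) (p : K[X]) (v : V) (j : Fin (d + 1)) :
    b.repr (aeval A p v) j = p.eval (θ j) * b.repr v j := by
  have hbp : ∀ i, aeval A p (b i) = p.eval (θ i) • b i := fun i =>
    Module.End.aeval_apply_of_hasEigenvector
      ⟨Module.End.mem_eigenspace_iff.2 (hb i), b.ne_zero i⟩
  have h : b.coord j ∘ₗ aeval A p = p.eval (θ j) • b.coord j := by
    refine b.ext fun i => ?_
    simp only [LinearMap.comp_apply, hbp, map_smul, LinearMap.smul_apply, Basis.coord_apply,
      Basis.repr_self, Finsupp.single_apply, smul_eq_mul]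
    split_ifs with hij
    · rw [hij]
    · simp
  simpa using LinearMap.congr_fun h v

theorem repr_apply_of_eigenbasis {b : Basis (Fin (d + 1)) K V} {A : V →ₗ[K] V}
    {θ : Fin (d + 1) → K} (hb : ∀ i, A (b i) = θ i • b i) (v : V) (j : Fin (d + 1)) :
    b.repr (A v) j = θ j * b.repr v j := by
  simpa using repr_aeval_apply hb X v j

theorem repr_apply_eq_sum (b : Basis (Fin (d + 1)) K V) (A : V →ₗ[K] V) (v : V)
    (i : Fin (d + 1)) :
    b.repr (A v) i = ∑ k, b.repr v k * b.repr (A (b k)) i := by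
  conv_lhs => rw [← b.sum_repr v]
  simp only [map_sum, map_smul, Finsupp.finsetSum_apply, Finsupp.smul_apply, smul_eq_mul]

/-- The product of the first `i` factors `X - θ_0, X - θ_1, …`. -/
noncomputable def rootProd (θ : Fin (d + 1) → K) (i : ℕ) : K[X] :=
  ∏ h ∈ Finset.univ.filter (fun h : Fin (d + 1) => (h : ℕ) < i), (X - C (θ h))

@[simp] theorem rootProd_zero (θ : Fin (d + 1) → K) : rootProd θ 0 = 1 := by
  simp [rootProd]

theorem rootProd_succ (θ : Fin (d + 1) → K) (i : Fin (d + 1)) :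
    rootProd θ (i + 1) = (X - C (θ i)) * rootProd θ i := by
  have h : Finset.univ.filter (fun h : Fin (d + 1) => (h : ℕ) < i + 1) =
      insert i (Finset.univ.filter (fun h : Fin (d + 1) => (h : ℕ) < i)) := by
    ext k
    simp only [Finset.mem_filter, Finset.mem_univ, true_and, Finset.mem_insert, Fin.ext_iff]
    omega
  rw [rootProd, h, Finset.prod_insert (by simp), rootProd]

theorem eval_rootProd_eq_zero (θ : Fin (d + 1) → K) {i : ℕ} {j : Fin (d + 1)} (h : (j : ℕ) < i) :
    (rootProd θ i).eval (θ j) = 0 := by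
  rw [rootProd, eval_prod]
  exact Finset.prod_eq_zero (i := j) (by simpa using h) (by simp)

theorem eval_rootProd_ne_zero {θ : Fin (d + 1) → K} (hθ : Function.Injective θ) {i : ℕ}
    {j : Fin (d + 1)} (h : i ≤ (j : ℕ)) : (rootProd θ i).eval (θ j) ≠ 0 := by
  rw [rootProd, eval_prod, Finset.prod_ne_zero_iff]
  intro k hk
  simp only [Finset.mem_filter, Finset.mem_univ, true_and] at hk
  simp only [eval_sub, eval_X, eval_C, sub_ne_zero]
  intro he
  have := hθ he
  subst this
  omega

end

/-! ### Pairs of eigenbases and their reversals -/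

/-- The matrix of `A` with respect to the basis `b` is irreducible tridiagonal. -/
structure IsIrredTridiagonal {K : Type*} [Field K] {V : Type*} [AddCommGroup V] [Module K V]
    {d : ℕ} (A : V →ₗ[K] V) (b : Basis (Fin (d + 1)) K V) : Prop where
  eq_zero : ∀ i j : Fin (d + 1), 1 < |(i : ℤ) - (j : ℤ)| → b.repr (A (b j)) i = 0
  ne_zero : ∀ i j : Fin (d + 1), |(i : ℤ) - (j : ℤ)| = 1 → b.repr (A (b j)) i ≠ 0

theorem IsIrredTridiagonal.rev {K : Type*} [Field K] {V : Type*} [AddCommGroup V] [Module K V]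
    {d : ℕ} {A : V →ₗ[K] V} {b : Basis (Fin (d + 1)) K V} (h : IsIrredTridiagonal A b) :
    IsIrredTridiagonal A (revBasis b) := by
  have key : ∀ i j : Fin (d + 1), |((i.rev : ℕ) : ℤ) - ((j.rev : ℕ) : ℤ)| = |(i : ℤ) - (j : ℤ)| := by
    intro i j
    have hi := Fin.val_rev i
    have hj := Fin.val_rev j
    rw [abs_sub_comm]
    congr 1
    omega
  constructor
  · intro i j hij
    simpa using h.eq_zero i.rev j.rev (by rwa [key])
  · intro i j hij
    simpa using h.ne_zero i.rev j.rev (by rwa [key])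

/-- A pair of linear transformations with distinct eigenvalues, each acting on an eigenbasis of
the other in an irreducible tridiagonal fashion. -/
structure LeonardBases (K : Type*) [Field K] (V : Type*) [AddCommGroup V] [Module K V]
    (d : ℕ) where
  A : V →ₗ[K] V
  As : V →ₗ[K] V
  θ : Fin (d + 1) → K
  θs : Fin (d + 1) → K
  e : Basis (Fin (d + 1)) K V
  es : Basis (Fin (d + 1)) K V
  θ_injective : Function.Injective θ
  θs_injective : Function.Injective θs
  A_e : ∀ i, A (e i) = θ i • e i
  As_es : ∀ i, As (es i) = θs i • es i
  tridiagonal : IsIrredTridiagonal A es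
  tridiagonal_dual : IsIrredTridiagonal As e

namespace LeonardBases

variable {K : Type*} [Field K] {V : Type*} [AddCommGroup V] [Module K V] {d : ℕ}
  (L : LeonardBases K V d)

/-- Reversal of the eigenbasis of `A`. -/
@[simps] noncomputable def revE : LeonardBases K V d where
  A := L.A
  As := L.As
  θ := fun i => L.θ i.rev
  θs := L.θs
  e := revBasis L.e
  es := L.es
  θ_injective := L.θ_injective.comp Fin.rev_injective
  θs_injective := L.θs_injective
  A_e i := by simp [L.A_e]
  As_es := L.As_es
  tridiagonal := L.tridiagonal
  tridiagonal_dual := L.tridiagonal_dual.rev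

/-- Reversal of the eigenbasis of `A*`. -/
@[simps] noncomputable def revEs : LeonardBases K V d where
  A := L.A
  As := L.As
  θ := L.θ
  θs := fun i => L.θs i.rev
  e := L.e
  es := revBasis L.es
  θ_injective := L.θ_injective
  θs_injective := L.θs_injective.comp Fin.rev_injective
  A_e := L.A_e
  As_es i := by simp [L.As_es]
  tridiagonal := L.tridiagonal.rev
  tridiagonal_dual := L.tridiagonal_dual

/-! ### The split basis -/

/-- The vectors `τ_i(A) v`, where `v` is the first eigenvector of `A*`. -/
noncomputable def splitVec (i : Fin (d + 1)) : V :=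
  aeval L.A (rootProd L.θ i) (L.es 0)

@[simp] theorem splitVec_zero : L.splitVec 0 = L.es 0 := by
  simp [splitVec]

theorem splitVec_succ (i : Fin d) :
    L.splitVec i.succ = L.A (L.splitVec i.castSucc) - L.θ i.castSucc • L.splitVec i.castSucc := by
  have h := rootProd_succ L.θ i.castSucc
  rw [Fin.val_castSucc] at h
  simp [splitVec, h, sub_mul]

theorem repr_e_splitVec (i j : Fin (d + 1)) :
    L.e.repr (L.splitVec i) j = (rootProd L.θ i).eval (L.θ j) * L.e.repr (L.es 0) j :=
  repr_aeval_apply L.A_e _ _ _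

theorem repr_e_splitVec_of_lt {i j : Fin (d + 1)} (h : j < i) :
    L.e.repr (L.splitVec i) j = 0 := by
  rw [repr_e_splitVec, eval_rootProd_eq_zero _ (by simpa using h), zero_mul]

/-- Each factor A − θ_h moves at most one step up the basis `es`, because A is tridiagonal there. -/
theorem repr_es_splitVec_of_lt {i j : Fin (d + 1)} (h : i < j) :
    L.es.repr (L.splitVec i) j = 0 := by
  induction i using Fin.induction generalizing j with
  | zero => simp [h.ne]
  | succ i ih =>
    have hj : i.castSucc < j := (Fin.castSucc_lt_succ).trans h
    rw [splitVec_succ, map_sub, map_smul, Finsupp.sub_apply, Finsupp.smul_apply, ih hj,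
      smul_zero, sub_zero, repr_apply_eq_sum]
    refine Finset.sum_eq_zero fun k _ => ?_
    by_cases hk : i.castSucc < k
    · rw [ih hk, zero_mul]
    · rw [L.tridiagonal.eq_zero, mul_zero]
      rw [lt_abs]
      left
      rw [Fin.lt_def] at *
      simp at *
      omega

/-- The diagonal entries of `A` in the eigenbasis of `A*`. -/
noncomputable def diag (k : Fin (d + 1)) : K :=
  L.es.repr (L.A (L.es k)) k

theorem repr_es_splitVec_succ (i : Fin d) :
    L.es.repr (L.splitVec i.succ) i.succ =
      L.es.repr (L.splitVec i.castSucc) i.castSucc *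
        L.es.repr (L.A (L.es i.castSucc)) i.succ := by
  rw [splitVec_succ, map_sub, map_smul, Finsupp.sub_apply, Finsupp.smul_apply,
    L.repr_es_splitVec_of_lt (Fin.castSucc_lt_succ), smul_zero, sub_zero, repr_apply_eq_sum]
  refine Finset.sum_eq_single _ (fun k _ hk => ?_) (by simp)
  by_cases hk' : i.castSucc < k
  · rw [L.repr_es_splitVec_of_lt hk', zero_mul]
  · rw [L.tridiagonal.eq_zero, mul_zero]
    rw [lt_abs]
    left
    rw [Fin.lt_def] at *
    rw [Ne, Fin.ext_iff] at hk
    simp at *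
    omega

theorem repr_es_splitVec_self_ne_zero (i : Fin (d + 1)) :
    L.es.repr (L.splitVec i) i ≠ 0 := by
  induction i using Fin.induction with
  | zero => simp
  | succ i ih =>
    rw [repr_es_splitVec_succ]
    exact mul_ne_zero ih (L.tridiagonal.ne_zero _ _ (by simp))

/-- The basis formed by the vectors `τ_i(A) v`. -/
noncomputable def splitBasis : Basis (Fin (d + 1)) K V :=
  (exists_basis_of_triangular L.es L.splitVec (fun _ _ h => L.repr_es_splitVec_of_lt h)
    L.repr_es_splitVec_self_ne_zero).choose

@[simp] theorem splitBasis_apply (i : Fin (d + 1)) : L.splitBasis i = L.splitVec i :=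
  congrFun (exists_basis_of_triangular L.es L.splitVec (fun _ _ h => L.repr_es_splitVec_of_lt h)
    L.repr_es_splitVec_self_ne_zero).choose_spec i

/-- The first eigenvector of `A*` is cyclic for `A`. -/
theorem repr_e_es_zero_ne_zero (j : Fin (d + 1)) : L.e.repr (L.es 0) j ≠ 0 := by
  intro h
  -- Polynomials in A only rescale the j-th coordinate, so if it vanished on es_0 it would vanish on
  -- the whole split basis.
  have h0 : L.e.coord j = 0 := L.splitBasis.ext fun i => by
    simp [repr_e_splitVec, h]
  have := LinearMap.congr_fun h0 (L.e j)
  simp at this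

theorem repr_e_splitVec_self_ne_zero (i : Fin (d + 1)) :
    L.e.repr (L.splitVec i) i ≠ 0 := by
  rw [repr_e_splitVec]
  exact mul_ne_zero (eval_rootProd_ne_zero L.θ_injective le_rfl) (L.repr_e_es_zero_ne_zero i)

/-- Triangularity with respect to `es` gives the flag [0*], and opposite triangularity with respect
to `e` gives [D]. The other three pairs of a starred and an unstarred flag follow by reversals. -/
theorem inducesFlags_splitBasis :
    InducesFlags (lines L.splitBasis) (partialSums (lines L.es))
      (partialSums (lines (revBasis L.e))) := by
  rw [← partialSums_lines_eq_of_triangular L.es L.splitBasis,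
    ← partialSums_lines_eq_of_triangular (revBasis L.e) (revBasis L.splitBasis)]
  · exact inducesFlags_lines _
  · intro i j h
    simpa using L.repr_e_splitVec_of_lt (Fin.rev_lt_rev.2 h)
  · intro i j h
    simpa using L.repr_es_splitVec_of_lt h

/-! ### The split sequence and the action of A* -/

/-- The superdiagonal entries of `A*` in the basis `τ_i(A) v`. -/
noncomputable def split (i : Fin d) : K :=
  (L.θs i.castSucc - L.θs i.succ) * ∑ k ∈ Finset.Iic i.castSucc, (L.diag k - L.θ k)

/-- The coefficient just below the leading one: each factor A − θ_k adds the diagonal entry of A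
minus θ_k, and the leading coefficients supply the common factor. -/
theorem repr_es_splitVec_succ_castSucc (i : Fin d) :
    L.es.repr (L.splitVec i.succ) i.castSucc =
      (∑ k ∈ Finset.Iic i.castSucc, (L.diag k - L.θ k)) *
        L.es.repr (L.splitVec i.castSucc) i.castSucc := by
  obtain ⟨n, hn⟩ := i
  induction n with
  | zero =>
    have h0 : (⟨0, hn⟩ : Fin d).castSucc = 0 := rfl
    have hI : Finset.Iic (0 : Fin (d + 1)) = {0} := by
      ext k
      simp only [Finset.mem_Iic, Finset.mem_singleton, Fin.le_def, Fin.ext_iff]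
      simp
    rw [splitVec_succ, h0, hI]
    simp [diag]
  | succ n ih =>
    have hj := ih (Nat.lt_of_succ_lt hn)
    set j : Fin d := ⟨n, Nat.lt_of_succ_lt hn⟩ with hjdef
    have hij : (⟨n + 1, hn⟩ : Fin d).castSucc = j.succ := rfl
    have hI : Finset.Iic j.succ = insert j.succ (Finset.Iic j.castSucc) := by
      ext k
      simp only [Finset.mem_Iic, Finset.mem_insert, Fin.le_def, Fin.ext_iff, Fin.val_succ,
        Fin.val_castSucc]
      omega
    rw [splitVec_succ, hij, hI, Finset.sum_insert (by simp), map_sub, map_smul,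
      Finsupp.sub_apply, Finsupp.smul_apply, repr_apply_eq_sum,
      Finset.sum_eq_add j.succ j.castSucc (Fin.castSucc_lt_succ).ne' _ (by simp) (by simp), hj,
      smul_eq_mul, repr_es_splitVec_succ, diag]
    · ring
    · rintro k - ⟨hk1, hk2⟩
      by_cases hk : j.succ < k
      · rw [L.repr_es_splitVec_of_lt hk, zero_mul]
      · rw [L.tridiagonal.eq_zero, mul_zero]
        rw [lt_abs]
        left
        rw [Fin.lt_def] at hk
        rw [Ne, Fin.ext_iff] at hk1 hk2
        simp only [Fin.val_succ, Fin.val_castSucc] at *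
        omega

/-- A* − θ*_{i+1} removes the top `es`-coordinate of u_{i+1}, while tridiagonality on `e` lowers its
first possible `e`-index by at most one. The result lies in the intersection of two opposite flag
components, which is the line of u_i; the coordinate at es_i identifies the scalar. -/
theorem As_splitVec_succ (i : Fin d) :
    L.As (L.splitVec i.succ) = L.θs i.succ • L.splitVec i.succ +
      L.split i • L.splitVec i.castSucc := by
  have hmem : L.As (L.splitVec i.succ) - L.θs i.succ • L.splitVec i.succ ∈
      lines L.splitBasis i.castSucc := by
    rw [L.inducesFlags_splitBasis.eq_inducedDecomposition]
    refine ⟨(mem_partialSums_lines _ _ _).2 fun j hj => ?_,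
      (mem_partialSums_lines _ _ _).2 fun j hj => ?_⟩
    · rw [map_sub, map_smul, Finsupp.sub_apply, Finsupp.smul_apply,
        repr_apply_of_eigenbasis L.As_es, smul_eq_mul, ← sub_mul]
      rcases (Fin.castSucc_lt_iff_succ_le.1 hj).eq_or_lt with rfl | hlt
      · simp
      · rw [L.repr_es_splitVec_of_lt hlt, mul_zero]
    · rw [revBasis_repr]
      have hj' : j.rev < i.castSucc := by
        rw [← Fin.rev_lt_rev, Fin.rev_rev]; exact hj
      rw [map_sub, map_smul, Finsupp.sub_apply, Finsupp.smul_apply,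
        L.repr_e_splitVec_of_lt (hj'.trans (Fin.castSucc_lt_succ)), smul_zero, sub_zero,
        repr_apply_eq_sum]
      refine Finset.sum_eq_zero fun k _ => ?_
      by_cases hk : k < i.succ
      · rw [L.repr_e_splitVec_of_lt hk, zero_mul]
      · rw [L.tridiagonal_dual.eq_zero, mul_zero]
        rw [lt_abs]
        right
        rw [Fin.lt_def] at *
        simp only [Fin.val_succ, Fin.val_castSucc] at *
        omega
  obtain ⟨c, hc⟩ := Submodule.mem_span_singleton.1 hmem
  rw [splitBasis_apply] at hc
  have h := congrArg (fun v => L.es.repr v i.castSucc) hc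
  simp only [map_sub, map_smul, Finsupp.sub_apply, Finsupp.smul_apply,
    repr_apply_of_eigenbasis L.As_es, smul_eq_mul, ← sub_mul,
    repr_es_splitVec_succ_castSucc] at h
  rw [← mul_assoc] at h
  have hc' : c = L.split i := mul_right_cancel₀ (L.repr_es_splitVec_self_ne_zero _) h
  rw [← hc', hc]
  abel

/-- The `e`-coordinates of the vectors `τ_i(A) v` satisfy a two-term recursion. -/
theorem split_mul_repr_e (i : Fin d) :
    L.split i * L.e.repr (L.splitVec i.castSucc) i.castSucc =
      L.e.repr (L.As (L.e i.succ)) i.castSucc * L.e.repr (L.splitVec i.succ) i.succ := by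
  have h := congrArg (fun v => L.e.repr v i.castSucc) (L.As_splitVec_succ i)
  simp only [map_add, map_smul, Finsupp.add_apply, Finsupp.smul_apply, smul_eq_mul,
    L.repr_e_splitVec_of_lt (Fin.castSucc_lt_succ (i := i)), mul_zero, zero_add] at h
  rw [← h, repr_apply_eq_sum, mul_comm]
  refine Finset.sum_eq_single _ (fun k _ hk => ?_) (by simp)
  by_cases hk' : k < i.succ
  · rw [L.repr_e_splitVec_of_lt hk', zero_mul]
  · rw [L.tridiagonal_dual.eq_zero, mul_zero]
    rw [lt_abs]
    right
    rw [Fin.lt_def] at *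
    rw [Ne, Fin.ext_iff] at hk
    simp only [Fin.val_succ, Fin.val_castSucc] at *
    omega

theorem split_ne_zero (i : Fin d) : L.split i ≠ 0 := by
  intro h
  have := L.split_mul_repr_e i
  rw [h, zero_mul, eq_comm, mul_eq_zero] at this
  rcases this with h | h
  · exact L.tridiagonal_dual.ne_zero _ _ (by simp) h
  · exact L.repr_e_splitVec_self_ne_zero _ h

theorem sum_diag : ∑ k, (L.diag k - L.θ k) = 0 := by
  have h1 : LinearMap.trace K V L.A = ∑ k, L.diag k := by
    rw [LinearMap.trace_eq_matrix_trace K L.es, Matrix.trace]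
    simp [LinearMap.toMatrix_apply, diag]
  have h2 : LinearMap.trace K V L.A = ∑ k, L.θ k := by
    rw [LinearMap.trace_eq_matrix_trace K L.e, Matrix.trace]
    simp [LinearMap.toMatrix_apply, L.A_e]
  rw [Finset.sum_sub_distrib, ← h1, ← h2, sub_self]

/-- After the substitution k ↦ d − k the two sums run over complementary index sets, so they are
opposite because A has equal traces in both bases. The difference of dual eigenvalues changes sign
too. -/
theorem split_revEs (i : Fin d) : L.revEs.split i = L.revE.split i.rev := by
  have hsum : ∑ k ∈ Finset.Iic i.castSucc, (L.revEs.diag k - L.revEs.θ k) =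
      -∑ k ∈ Finset.Iic i.rev.castSucc, (L.revE.diag k - L.revE.θ k) := by
    rw [eq_neg_iff_add_eq_zero, ← L.revE.sum_diag,
      ← Finset.sum_compl_add_sum (Finset.Iic i.rev.castSucc)]
    congr 1
    refine Finset.sum_nbij' Fin.rev Fin.rev ?_ ?_ (by simp) (by simp) ?_
    · intro k hk
      simp only [Finset.mem_Iic, Finset.mem_compl, Fin.le_def, Fin.val_rev,
        Fin.val_castSucc] at *
      omega
    · intro k hk
      simp only [Finset.mem_Iic, Finset.mem_compl, Fin.le_def, Fin.val_rev,
        Fin.val_castSucc] at *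
      omega
    · intro k _
      simp [diag]
  rw [split, split, hsum]
  simp only [revEs_θs, revE_θs, Fin.rev_castSucc, Fin.rev_succ]
  ring

end LeonardBases
end Leonard

namespace Leonard

/-! ### The switching element on split vectors -/

/-- The product of the first `r` terms of a sequence. -/
def initialProd {K : Type*} [Field K] {d : ℕ} (f : Fin d → K) (r : ℕ) : K :=
  ∏ i ∈ Finset.univ.filter (fun i : Fin d => (i : ℕ) < r), f i

theorem initialProd_zero {K : Type*} [Field K] {d : ℕ} (f : Fin d → K) :
    initialProd f 0 = 1 := by
  simp [initialProd]

theorem initialProd_succ {K : Type*} [Field K] {d : ℕ} (f : Fin d → K) (i : Fin d) :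
    initialProd f (i + 1) = f i * initialProd f i := by
  have h : Finset.univ.filter (fun h : Fin d => (h : ℕ) < i + 1) =
      insert i (Finset.univ.filter (fun h : Fin d => (h : ℕ) < i)) := by
    ext k
    simp only [Finset.mem_filter, Finset.mem_univ, true_and, Finset.mem_insert, Fin.ext_iff]
    omega
  rw [initialProd, h, Finset.prod_insert (by simp), initialProd]

theorem initialProd_ne_zero {K : Type*} [Field K] {d : ℕ} {f : Fin d → K} (hf : ∀ i, f i ≠ 0)
    (r : ℕ) : initialProd f r ≠ 0 :=
  Finset.prod_ne_zero_iff.2 fun i _ => hf i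

namespace LeonardBases

variable {K : Type*} [Field K] {V : Type*} [AddCommGroup V] [Module K V] {d : ℕ}
  (L : LeonardBases K V d)

/-- Reversing `es` changes neither A* nor `e`, so both two-term recursions contain the same nonzero
entry of A*, which cancels. The identity is cross-multiplied to avoid division. -/
theorem repr_e_splitVec_revEs_mul (r : Fin (d + 1)) :
    L.e.repr (L.revEs.splitVec r) r * initialProd L.split r * L.e.repr (L.es 0) 0 =
      L.e.repr (L.splitVec r) r * initialProd L.revEs.split r * L.e.repr (L.revEs.es 0) 0 := by
  induction r using Fin.induction with
  | zero => simp [initialProd_zero, mul_comm]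
  | succ i ih =>
    have hB : L.e.repr (L.As (L.e i.succ)) i.castSucc ≠ 0 :=
      L.tridiagonal_dual.ne_zero _ _ (by simp)
    have h1 := L.split_mul_repr_e i
    have h2 : L.revEs.split i * L.e.repr (L.revEs.splitVec i.castSucc) i.castSucc =
      L.e.repr (L.As (L.e i.succ)) i.castSucc * L.e.repr (L.revEs.splitVec i.succ) i.succ :=
      L.revEs.split_mul_repr_e i
    rw [Fin.val_castSucc] at ih
    rw [Fin.val_succ, initialProd_succ, initialProd_succ]
    refine mul_left_cancel₀ hB ?_
    linear_combination (L.split i * L.revEs.split i) * ih -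
      L.split i * initialProd L.split i * L.e.repr (L.es 0) 0 * h2 +
      L.revEs.split i * initialProd L.revEs.split i * L.e.repr (L.revEs.es 0) 0 * h1

/-- The ratio between the coordinates of the last and the first eigenvector of `A*`. -/
theorem repr_e_es_last_mul (r : Fin (d + 1)) :
    L.e.repr (L.revEs.es 0) r * initialProd L.split r * L.e.repr (L.es 0) 0 =
      L.e.repr (L.es 0) r * initialProd L.revEs.split r * L.e.repr (L.revEs.es 0) 0 := by
  have h := L.repr_e_splitVec_revEs_mul r
  have h' : L.e.repr (L.revEs.splitVec r) r =
    (rootProd L.θ r).eval (L.θ r) * L.e.repr (L.revEs.es 0) r := L.revEs.repr_e_splitVec r r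
  rw [h', repr_e_splitVec] at h
  refine mul_left_cancel₀ (eval_rootProd_ne_zero L.θ_injective (le_refl (r : ℕ))) ?_
  linear_combination h

/-- `S` is diagonal in the eigenbasis of `A`, with the eigenvalues of the switching element. -/
def IsSwitching (S : V →ₗ[K] V) : Prop :=
  ∀ r, S (L.e r) = (initialProd L.revEs.split r / initialProd L.split r) • L.e r

variable {L} {S : V →ₗ[K] V}

/-- The scalar by which the switching element maps one vector to the other. -/
noncomputable def switchingScalar (L : LeonardBases K V d) : K :=
  L.e.repr (L.es 0) 0 / L.e.repr (L.revEs.es 0) 0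

theorem switchingScalar_ne_zero (L : LeonardBases K V d) : L.switchingScalar ≠ 0 :=
  div_ne_zero (L.repr_e_es_zero_ne_zero 0) (L.revEs.repr_e_es_zero_ne_zero 0)

/-- Both S and p(A) are diagonal on `e`, so everything reduces to the coordinate ratio in
`repr_e_es_last_mul`. -/
theorem IsSwitching.apply_aeval (hS : L.IsSwitching S) (p : K[X]) :
    S (aeval L.A p (L.es 0)) = L.switchingScalar • aeval L.A p (L.revEs.es 0) := by
  refine L.e.ext_elem fun r => ?_
  rw [repr_apply_of_eigenbasis hS, map_smul, Finsupp.smul_apply, repr_aeval_apply L.A_e,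
    repr_aeval_apply L.A_e, switchingScalar, smul_eq_mul]
  have h := L.repr_e_es_last_mul r
  have h1 := initialProd_ne_zero L.split_ne_zero r
  have h2 : L.e.repr (L.revEs.es 0) 0 ≠ 0 := L.revEs.repr_e_es_zero_ne_zero 0
  field_simp
  linear_combination -p.eval (L.θ r) * h

theorem IsSwitching.apply_splitVec (hS : L.IsSwitching S) (i : Fin (d + 1)) :
    S (L.splitVec i) = L.switchingScalar • L.revEs.splitVec i :=
  hS.apply_aeval _

theorem IsSwitching.apply_splitVec_revE (hS : L.IsSwitching S) (i : Fin (d + 1)) :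
    S (L.revE.splitVec i) = L.switchingScalar • L.revE.revEs.splitVec i :=
  hS.apply_aeval _

/-- A linear transformation that respects both pairs of split decompositions is a multiple of
the switching element. -/
theorem IsSwitching.eq_smul_of_mem_span (hS : L.IsSwitching S) {X : V →ₗ[K] V}
    (hX : ∀ i, X (L.splitVec i) ∈ Submodule.span K {L.revEs.splitVec i})
    (hX' : ∀ i, X (L.revE.splitVec i) ∈ Submodule.span K {L.revE.revEs.splitVec i}) :
    ∃ c : K, X = c • S := by
  simp only [Submodule.mem_span_singleton] at hX hX'
  choose b hb using hX
  choose a ha using hX'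
  have hβ : L.e.repr (L.revEs.es 0) 0 ≠ 0 := L.revEs.repr_e_es_zero_ne_zero 0
  have hα : L.e.repr (L.es 0) 0 ≠ 0 := L.repr_e_es_zero_ne_zero 0
  -- For i ≥ 1 the root θ_0 of τ_i annihilates both sides on the split basis; only i = 0
  -- contributes.
  have hcoord : L.e.coord 0 ∘ₗ X = (b 0 / L.switchingScalar) • L.e.coord 0 := by
    refine L.splitBasis.ext fun i => ?_
    have h' : L.e.repr (L.revEs.splitVec i) 0 =
      (rootProd L.θ i).eval (L.θ 0) * L.e.repr (L.revEs.es 0) 0 := L.revEs.repr_e_splitVec i 0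
    simp only [LinearMap.comp_apply, splitBasis_apply, ← hb, map_smul, LinearMap.smul_apply,
      Basis.coord_apply, smul_eq_mul, switchingScalar, repr_e_splitVec, h']
    rcases Fin.eq_zero_or_eq_succ i with rfl | ⟨j, rfl⟩
    · simp
      field_simp
    · rw [eval_rootProd_eq_zero _ (by simp)]
      simp
  have hab : ∀ i, a i = b 0 := by
    intro i
    have h := LinearMap.congr_fun hcoord (L.revE.splitVec i)
    have h1 : L.e.repr (L.revE.splitVec i) 0 =
        (rootProd L.revE.θ i).eval (L.θ 0) * L.e.repr (L.es 0) 0 :=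
      repr_aeval_apply L.A_e _ _ _
    have h2 : L.e.repr (L.revE.revEs.splitVec i) 0 =
        (rootProd L.revE.θ i).eval (L.θ 0) * L.e.repr (L.revEs.es 0) 0 :=
      repr_aeval_apply L.A_e _ _ _
    -- In the reversed order θ_0 comes last, so it is not a root of η_i for i ≤ d.
    have h3 : (rootProd L.revE.θ i).eval (L.θ 0) ≠ 0 := by
      have := eval_rootProd_ne_zero L.revE.θ_injective (i := (i : ℕ)) (j := Fin.last d)
        (Nat.le_of_lt_succ i.2)
      simpa using this
    simp only [LinearMap.comp_apply, ← ha, map_smul, LinearMap.smul_apply, Basis.coord_apply,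
      smul_eq_mul, h1, h2, switchingScalar] at h
    field_simp at h
    exact h
  refine ⟨b 0 / L.switchingScalar, L.revE.splitBasis.ext fun i => ?_⟩
  rw [splitBasis_apply, LinearMap.smul_apply, hS.apply_splitVec_revE, smul_smul,
    div_mul_cancel₀ _ L.switchingScalar_ne_zero, ← ha, hab]

/-! ### The split sequence as a ratio of coordinates -/

/-- The coefficient of the first eigenvector of `A*` in the vectors `τ_i(A) v`. -/
theorem split_mul_repr_es (L : LeonardBases K V d) (i : Fin d) :
    (L.θs 0 - L.θs i.succ) * L.es.repr (L.splitVec i.succ) 0 =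
      L.split i * L.es.repr (L.splitVec i.castSucc) 0 := by
  have h := congrArg (fun v => L.es.repr v 0) (L.As_splitVec_succ i)
  simp only [map_add, map_smul, Finsupp.add_apply, Finsupp.smul_apply, smul_eq_mul,
    repr_apply_of_eigenbasis L.As_es] at h
  linear_combination h

theorem repr_es_splitVec_zero_ne_zero (L : LeonardBases K V d) (i : Fin (d + 1)) :
    L.es.repr (L.splitVec i) 0 ≠ 0 := by
  induction i using Fin.induction with
  | zero => simp
  | succ i ih =>
    have h := mul_ne_zero (L.split_ne_zero i) ih
    rw [← split_mul_repr_es] at h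
    exact right_ne_zero_of_mul h

theorem split_eq (L : LeonardBases K V d) (i : Fin d) :
    L.split i = (L.θs 0 - L.θs i.succ) * (L.es.repr (L.splitVec i.succ) 0 /
      L.es.repr (L.splitVec i.castSucc) 0) := by
  rw [← mul_div_assoc, split_mul_repr_es, mul_div_cancel_right₀]
  exact L.repr_es_splitVec_zero_ne_zero _

end LeonardBases

/-! ### From the matrix algebra to linear maps -/

section Module

variable {K : Type*} [Field K] {𝒜 : Type*} [Ring 𝒜] [Algebra K 𝒜]
  {V : Type*} [AddCommGroup V] [Module K V] [Module 𝒜 V] [IsScalarTower K 𝒜 V] {d : ℕ}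

theorem act_aeval (A : 𝒜) (p : K[X]) :
    act (K := K) V (aeval A p) = aeval (act (K := K) V A) p :=
  (aeval_algHom_apply (Algebra.lsmul K K V) A p).symm

theorem act_mul (X Y : 𝒜) : act (K := K) V (X * Y) = act V X ∘ₗ act V Y :=
  map_mul (Algebra.lsmul K K V) X Y

theorem act_smul (c : K) (X : 𝒜) : act (K := K) V (c • X) = c • act V X :=
  map_smul (Algebra.lsmul K K V) c X

/-- A matrix ring over a field is simple, so its homomorphism to the nonzero ring of endomorphisms
of V is injective. -/
theorem act_injective (h𝒜 : Nonempty (𝒜 ≃ₐ[K] Matrix (Fin (d + 1)) (Fin (d + 1)) K))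
    [IsSimpleModule 𝒜 V] : Function.Injective (act (K := K) V : 𝒜 → (V →ₗ[K] V)) := by
  obtain ⟨f⟩ := h𝒜
  have : Nontrivial V := IsSimpleModule.nontrivial 𝒜 V
  let g : Matrix (Fin (d + 1)) (Fin (d + 1)) K →+* Module.End K V :=
    (Algebra.lsmul K K V : 𝒜 →ₐ[K] Module.End K V).toRingHom.comp f.symm.toAlgHom.toRingHom
  have hg : Function.Injective g := g.injective
  intro X Y h
  have : g (f X) = g (f Y) := by
    change act V (f.symm (f X)) = act V (f.symm (f Y))
    simpa using h
  exact f.injective (hg this)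

/-- A simple module over the `n × n` matrices has a spanning family of `n` vectors. -/
theorem exists_span_eq_top (h𝒜 : Nonempty (𝒜 ≃ₐ[K] Matrix (Fin (d + 1)) (Fin (d + 1)) K))
    [IsSimpleModule 𝒜 V] :
    ∃ w : Fin (d + 1) → V, Submodule.span K (Set.range w) = ⊤ := by
  obtain ⟨f⟩ := h𝒜
  have : Nontrivial V := IsSimpleModule.nontrivial 𝒜 V
  obtain ⟨v, hv⟩ := exists_ne (0 : V)
  obtain ⟨k, hk⟩ : ∃ k, f.symm (Matrix.single k k 1) • v ≠ 0 := by
    by_contra! h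
    apply hv
    have h1 : (1 : 𝒜) = ∑ k, f.symm (Matrix.single k k 1) := by
      rw [← map_sum, Matrix.sum_single_one, map_one]
    rw [← one_smul 𝒜 v, h1, Finset.sum_smul]
    exact Finset.sum_eq_zero fun k _ => h k
  refine ⟨fun i => f.symm (Matrix.single i k 1) • v, eq_top_iff.2 fun x _ => ?_⟩
  obtain ⟨X, rfl⟩ := IsSimpleModule.toSpanSingleton_surjective 𝒜 hk x
  -- Multiplication by the k-th diagonal matrix unit keeps only column k, so d + 1 matrix units
  -- suffice.
  have hX : X * f.symm (Matrix.single k k 1) =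
      ∑ i, f X i k • f.symm (Matrix.single i k 1) := by
    apply f.injective
    simp only [map_mul, map_sum, map_smul, AlgEquiv.apply_symm_apply]
    ext i j
    simp [Matrix.sum_apply, Matrix.mul_apply, Matrix.single_apply, ite_and]
  rw [LinearMap.toSpanSingleton_apply, ← mul_smul, hX, Finset.sum_smul]
  refine Submodule.sum_mem _ fun i _ => ?_
  rw [smul_assoc]
  exact Submodule.smul_mem _ _ (Submodule.subset_span ⟨i, rfl⟩)

/-- A multiplicity-free element has an eigenbasis, and its primitive idempotents are the
coordinate projections. -/
theorem IsPrimitiveIdempotentOrdering.exists_basis {A : 𝒜} {θ : Fin (d + 1) → K}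
    {E : Fin (d + 1) → 𝒜} (h : IsPrimitiveIdempotentOrdering V A θ E)
    (hV : ∃ w : Fin (d + 1) → V, Submodule.span K (Set.range w) = ⊤) :
    ∃ b : Basis (Fin (d + 1)) K V, (∀ i, act (K := K) V A (b i) = θ i • b i) ∧
      ∀ i v, act (K := K) V (E i) v = b.repr v i • b i := by
  obtain ⟨w, hw⟩ := hV
  have : FiniteDimensional K V :=
    Module.finite_def.2 (Submodule.fg_def.2 ⟨_, Set.finite_range w, hw⟩)
  choose v hv using fun i => (h.hasEigenvalue i).exists_hasEigenvector
  have hli : LinearIndependent K v := Module.End.eigenvectors_linearIndependent' _ θ h.injective v hv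
  -- The d + 1 independent eigenvectors bound the dimension below, the spanning family above.
  have hdim : Fintype.card (Fin (d + 1)) = finrank K V := by
    refine le_antisymm hli.fintype_card_le_finrank ?_
    rw [← finrank_top K V, ← hw]
    exact finrank_range_le_card w
  have hb := coe_basisOfLinearIndependentOfCardEqFinrank hli hdim
  set b := basisOfLinearIndependentOfCardEqFinrank hli hdim
  have hbA : ∀ i, act (K := K) V A (b i) = θ i • b i := fun i => by
    rw [hb]; exact (hv i).apply_eq_smul
  refine ⟨b, hbA, fun i x => b.ext_elem fun j => ?_⟩
  rw [h.eq_prod, act_aeval, repr_aeval_apply hbA, eval_prod, map_smul, Finsupp.smul_apply,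
    Basis.repr_self, smul_eq_mul]
  rcases eq_or_ne j i with rfl | hji
  · rw [Finset.prod_eq_one, one_mul, Finsupp.single_eq_same, mul_one]
    intro k hk
    have : θ j - θ k ≠ 0 := sub_ne_zero.2 (h.injective.ne (Finset.ne_of_mem_erase hk).symm)
    simp [this]
  · rw [Finset.prod_eq_zero (i := j) (by simp [hji]) (by simp), zero_mul,
      Finsupp.single_eq_of_ne hji, mul_zero]

theorem imageOf_eq_span {E : 𝒜} {b : Basis (Fin (d + 1)) K V} {i : Fin (d + 1)}
    (h : ∀ v, act (K := K) V E v = b.repr v i • b i) : imageOf V E = Submodule.span K {b i} := by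
  refine le_antisymm ?_ ?_
  · rintro _ ⟨v, rfl⟩
    rw [h]
    exact Submodule.smul_mem _ _ (Submodule.mem_span_singleton_self _)
  · rw [Submodule.span_singleton_le_iff_mem]
    exact ⟨b i, by simp [h]⟩

/-- E_i A E_j acts as a map of rank at most one whose only matrix entry is that of A at (i, j).
Faithfulness of the action is needed for the nonvanishing entries. -/
theorem isIrredTridiagonal_of_idempotents
    (hact : Function.Injective (act (K := K) V : 𝒜 → (V →ₗ[K] V))) {A : 𝒜}
    {E : Fin (d + 1) → 𝒜} {b : Basis (Fin (d + 1)) K V}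
    (hE : ∀ i v, act (K := K) V (E i) v = b.repr v i • b i)
    (h : ∀ i j : Fin (d + 1), (1 < |(i : ℤ) - (j : ℤ)| → E i * A * E j = 0) ∧
      (|(i : ℤ) - (j : ℤ)| = 1 → E i * A * E j ≠ 0)) :
    IsIrredTridiagonal (act (K := K) V A) b := by
  have key : ∀ i j v, act (K := K) V (E i * A * E j) v =
      (b.repr v j * b.repr (act (K := K) V A (b j)) i) • b i := by
    intro i j v
    simp [act_mul, hE]
  have hzero : act (K := K) V (0 : 𝒜) = 0 := map_zero (Algebra.lsmul K K V)
  constructor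
  · intro i j hij
    have := key i j (b j)
    rw [(h i j).1 hij, hzero] at this
    simpa [b.ne_zero] using this.symm
  · intro i j hij h0
    refine (h i j).2 hij (hact ?_)
    rw [hzero]
    ext v
    rw [key, h0]
    simp

end Module

/-! ### Realizing a Leonard system by eigenbases -/

namespace LeonardSystem

variable {K : Type*} [Field K] {𝒜 : Type*} [Ring 𝒜] [Algebra K 𝒜]
  {V : Type*} [AddCommGroup V] [Module K V] [Module 𝒜 V] [IsScalarTower K 𝒜 V] {d : ℕ}
  (Φ : LeonardSystem K 𝒜 V d)

/-- `L` is the pair of eigenbases that realizes the Leonard system `Φ` on `V`. -/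
structure IsRealizedBy (L : LeonardBases K V d) : Prop where
  A_eq : L.A = act V Φ.A
  θ_eq : L.θ = Φ.θ
  θs_eq : L.θs = Φ.θs
  act_E : ∀ i v, act (K := K) V (Φ.E i) v = L.e.repr v i • L.e i
  act_Es : ∀ i v, act (K := K) V (Φ.Es i) v = L.es.repr v i • L.es i

theorem exists_isRealizedBy
    (hact : Function.Injective (act (K := K) V : 𝒜 → (V →ₗ[K] V)))
    (hV : ∃ w : Fin (d + 1) → V, Submodule.span K (Set.range w) = ⊤) :
    ∃ L : LeonardBases K V d, Φ.IsRealizedBy L := by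
  obtain ⟨e, hA, hE⟩ := Φ.idempotents.exists_basis hV
  obtain ⟨es, hAs, hEs⟩ := Φ.idempotents_dual.exists_basis hV
  exact ⟨⟨act V Φ.A, act V Φ.As, Φ.θ, Φ.θs, e, es, Φ.idempotents.injective,
    Φ.idempotents_dual.injective, hA, hAs, isIrredTridiagonal_of_idempotents hact hEs Φ.tridiagonal,
    isIrredTridiagonal_of_idempotents hact hE Φ.tridiagonal_dual⟩, rfl, rfl, rfl, hE, hEs⟩

namespace IsRealizedBy

variable {Φ} {L : LeonardBases K V d} (h : Φ.IsRealizedBy L)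

include h

/-- E*_0 is the projection onto the line of es_0, so a single diagonal entry contributes to the
trace. This turns the trace ratios into those of `split_eq`. -/
theorem tr_aeval (p : K[X]) :
    tr V (aeval Φ.A p * Φ.Es 0) = L.es.repr (aeval L.A p (L.es 0)) 0 := by
  rw [tr, LinearMap.trace_eq_matrix_trace K L.es, Matrix.trace,
    Finset.sum_eq_single 0 _ (by simp)]
  · simp [LinearMap.toMatrix_apply, act_mul, act_aeval, h.act_Es, h.A_eq]
  · intro k _ hk
    simp [LinearMap.toMatrix_apply, act_mul, h.act_Es, hk]

theorem firstSplit_eq (i : Fin d) : Φ.firstSplit i = L.split i := by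
  rw [L.split_eq, firstSplit, h.tr_aeval, h.tr_aeval, h.θs_eq]
  simp only [LeonardBases.splitVec, h.θ_eq]
  rfl

theorem secondSplit_eq (i : Fin d) : Φ.secondSplit i = L.revE.split i := by
  have heta : ∀ n, Φ.eta n = rootProd L.revE.θ n := fun n => by
    simp only [eta, rootProd, LeonardBases.revE_θ, h.θ_eq]
  rw [L.revE.split_eq, secondSplit, h.tr_aeval, h.tr_aeval, ← h.θs_eq, heta, heta]
  rfl

theorem isSwitching : L.IsSwitching (act V Φ.switchingElement) := by
  intro r
  have hsum : act (K := K) V Φ.switchingElement = ∑ r : Fin (d + 1),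
      (initialProd L.revEs.split r / initialProd L.split r) • act V (Φ.E r) := by
    rw [switchingElement]
    -- The last r terms of the second split sequence become the first r terms of the split sequence
    -- with `es` reversed.
    simp only [h.firstSplit_eq, h.secondSplit_eq, ← LeonardBases.split_revEs]
    refine (map_sum (Algebra.lsmul K K V) _ _).trans (Finset.sum_congr rfl fun r _ => ?_)
    exact act_smul _ _
  rw [hsum, LinearMap.sum_apply, Finset.sum_eq_single r _ (by simp)]
  · simp [h.act_E]
  · intro k _ hk
    simp [h.act_E, hk.symm]

theorem flag_zero : Φ.flag .zero = partialSums (lines L.e) := by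
  rw [flag]
  congr 1
  exact funext fun i => imageOf_eq_span (h.act_E i)

theorem flag_D : Φ.flag .D = partialSums (lines (revBasis L.e)) := by
  rw [flag, ← inversion_lines]
  congr 2
  exact funext fun i => imageOf_eq_span (h.act_E i)

theorem flag_zeroStar : Φ.flag .zeroStar = partialSums (lines L.es) := by
  rw [flag]
  congr 1
  exact funext fun i => imageOf_eq_span (h.act_Es i)

theorem flag_DStar : Φ.flag .DStar = partialSums (lines (revBasis L.es)) := by
  rw [flag, ← inversion_lines]
  congr 2
  exact funext fun i => imageOf_eq_span (h.act_Es i)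

theorem inducesFlags_zeroStar_D :
    InducesFlags (lines L.splitBasis) (Φ.flag .zeroStar) (Φ.flag .D) := by
  rw [h.flag_zeroStar, h.flag_D]
  exact L.inducesFlags_splitBasis

theorem inducesFlags_zeroStar_zero :
    InducesFlags (lines L.revE.splitBasis) (Φ.flag .zeroStar) (Φ.flag .zero) := by
  rw [h.flag_zeroStar, h.flag_zero]
  simpa using L.revE.inducesFlags_splitBasis

theorem inducesFlags_DStar_D :
    InducesFlags (lines L.revEs.splitBasis) (Φ.flag .DStar) (Φ.flag .D) := by
  rw [h.flag_DStar, h.flag_D]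
  exact L.revEs.inducesFlags_splitBasis

theorem inducesFlags_DStar_zero :
    InducesFlags (lines L.revE.revEs.splitBasis) (Φ.flag .DStar) (Φ.flag .zero) := by
  rw [h.flag_DStar, h.flag_zero]
  simpa using L.revE.revEs.inducesFlags_splitBasis

theorem opposite (z w : Omega) (hzw : z ≠ w) : Opposite (Φ.flag z) (Φ.flag w) := by
  have h1 : Opposite (Φ.flag .zero) (Φ.flag .D) := by
    rw [h.flag_zero, h.flag_D]
    exact ⟨_, inducesFlags_lines _⟩
  have h2 : Opposite (Φ.flag .zeroStar) (Φ.flag .DStar) := by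
    rw [h.flag_zeroStar, h.flag_DStar]
    exact ⟨_, inducesFlags_lines _⟩
  have h3 : Opposite (Φ.flag .zeroStar) (Φ.flag .D) := ⟨_, h.inducesFlags_zeroStar_D⟩
  have h4 : Opposite (Φ.flag .zeroStar) (Φ.flag .zero) := ⟨_, h.inducesFlags_zeroStar_zero⟩
  have h5 : Opposite (Φ.flag .DStar) (Φ.flag .D) := ⟨_, h.inducesFlags_DStar_D⟩
  have h6 : Opposite (Φ.flag .DStar) (Φ.flag .zero) := ⟨_, h.inducesFlags_DStar_zero⟩
  cases z <;> cases w <;> first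
    | exact absurd rfl hzw
    | assumption
    | exact Opposite.symm ‹_›

end IsRealizedBy

end LeonardSystem

/-! ### Images of decompositions and the main theorem -/

theorem applySeq_lines_le_iff {K : Type*} [Field K] {𝒜 : Type*} [Ring 𝒜] [Algebra K 𝒜]
    {V : Type*} [AddCommGroup V] [Module K V] [Module 𝒜 V] [IsScalarTower K 𝒜 V] {d : ℕ}
    (X : 𝒜) (b b' : Basis (Fin (d + 1)) K V) :
    applySeq X (lines b) ≤ lines b' ↔
      ∀ i, act (K := K) V X (b i) ∈ Submodule.span K {b' i} := by
  refine forall_congr' fun i => ?_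
  rw [applySeq, lines, Submodule.map_span, Set.image_singleton,
    Submodule.span_singleton_le_iff_mem, lines]

theorem applySeq_lines_eq {K : Type*} [Field K] {𝒜 : Type*} [Ring 𝒜] [Algebra K 𝒜]
    {V : Type*} [AddCommGroup V] [Module K V] [Module 𝒜 V] [IsScalarTower K 𝒜 V] {d : ℕ}
    {X : 𝒜} {b b' : Basis (Fin (d + 1)) K V} {c : K} (hc : c ≠ 0)
    (h : ∀ i, act (K := K) V X (b i) = c • b' i) :
    applySeq X (lines b) = lines b' := by
  funext i
  rw [applySeq, lines, Submodule.map_span, Set.image_singleton, h, lines,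
    Submodule.span_singleton_smul_eq hc.isUnit]

end Leonard

theorem theorem9p1 {K : Type*} [Field K] {d : ℕ} {𝒜 : Type*} [Ring 𝒜] [Algebra K 𝒜]
    (h𝒜 : Nonempty (𝒜 ≃ₐ[K] Matrix (Fin (d + 1)) (Fin (d + 1)) K))
    {V : Type*} [AddCommGroup V] [Module K V] [Module 𝒜 V] [IsScalarTower K 𝒜 V]
    [IsSimpleModule 𝒜 V] (Φ : Leonard.LeonardSystem K 𝒜 V d) :
    -- the flags are mutually opposite, so that the decompositions `[zw]` make sense
    (∀ z w : Leonard.Omega, z ≠ w → Leonard.Opposite (Φ.flag z) (Φ.flag w)) ∧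
    ∀ X : 𝒜, X ≠ 0 →
      ((∃ c : K, X = c • Φ.switchingElement) ↔
        (Leonard.applySeq X (Φ.decomposition .zeroStar .zero) ≤ Φ.decomposition .DStar .zero ∧
          Leonard.applySeq X (Φ.decomposition .zeroStar .D) ≤ Φ.decomposition .DStar .D)) ∧
      ((Leonard.applySeq X (Φ.decomposition .zeroStar .zero) ≤ Φ.decomposition .DStar .zero ∧
          Leonard.applySeq X (Φ.decomposition .zeroStar .D) ≤ Φ.decomposition .DStar .D) →
        (Leonard.applySeq X (Φ.decomposition .zeroStar .zero) = Φ.decomposition .DStar .zero ∧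
          Leonard.applySeq X (Φ.decomposition .zeroStar .D) = Φ.decomposition .DStar .D)) := by
  have hact := Leonard.act_injective (V := V) h𝒜
  obtain ⟨L, hL⟩ := Φ.exists_isRealizedBy hact (Leonard.exists_span_eq_top h𝒜)
  have hS := hL.isSwitching
  have h1 := hL.inducesFlags_zeroStar_zero.eq_inducedDecomposition
  have h2 := hL.inducesFlags_DStar_zero.eq_inducedDecomposition
  have h3 := hL.inducesFlags_zeroStar_D.eq_inducedDecomposition
  have h4 := hL.inducesFlags_DStar_D.eq_inducedDecomposition
  refine ⟨hL.opposite, fun X hX => ?_⟩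
  simp only [Leonard.LeonardSystem.decomposition]
  rw [← h1, ← h2, ← h3, ← h4]
  have hbwd : (Leonard.applySeq X (Leonard.lines L.revE.splitBasis) ≤
        Leonard.lines L.revE.revEs.splitBasis ∧
      Leonard.applySeq X (Leonard.lines L.splitBasis) ≤ Leonard.lines L.revEs.splitBasis) →
      ∃ c : K, X = c • Φ.switchingElement := by
    rintro ⟨h, h'⟩
    rw [Leonard.applySeq_lines_le_iff] at h h'
    simp only [Leonard.LeonardBases.splitBasis_apply] at h h'
    obtain ⟨c, hc⟩ := hS.eq_smul_of_mem_span h' h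
    exact ⟨c, hact (by rw [hc, Leonard.act_smul])⟩
  have hfwd : (∃ c : K, X = c • Φ.switchingElement) →
      (Leonard.applySeq X (Leonard.lines L.revE.splitBasis) =
        Leonard.lines L.revE.revEs.splitBasis ∧
      Leonard.applySeq X (Leonard.lines L.splitBasis) = Leonard.lines L.revEs.splitBasis) := by
    rintro ⟨c, rfl⟩
    -- X ≠ 0 makes the scalar nonzero, which upgrades the inclusions of lines to equalities.
    have hc : c ≠ 0 := by
      rintro rfl
      exact hX (zero_smul _ _)
    have hc' := mul_ne_zero hc L.switchingScalar_ne_zero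
    refine ⟨Leonard.applySeq_lines_eq hc' fun i => ?_, Leonard.applySeq_lines_eq hc' fun i => ?_⟩
    · simp [Leonard.act_smul, hS.apply_splitVec_revE, smul_smul]
    · simp [Leonard.act_smul, hS.apply_splitVec, smul_smul]
  exact ⟨⟨fun h => ⟨(hfwd h).1.le, (hfwd h).2.le⟩, hbwd⟩, fun h => hfwd (hbwd h)⟩
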